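/- Let $0<t\le 1$. For a Jordan curve $\Gamma\subset\mathbb R^2$ and distinct $x,y\in\Gamma$, let $\Gamma(x,y)$ denote the one of the two subarcs of $\Gamma$ with endpoints $x,y$ that has the smaller diameter (either one if the diameters are equal). A Jordan curve $\Gamma\subset\mathbb R^2$ is called a $t$-quasicircle if there is a constant $C\ge 1$ such that $\operatorname{diam}\Gamma(x,y)\le C|x-y|^t$ for all distinct $x,y\in\Gamma$. Let $\mathbb T$ be the unit circle in $\mathbb C$ with the Euclidean metric. A map $f:\mathbb T\to\mathbb R^2$ is called weakly $(R,t)$-quasisymmetric if it is a homeomorphism onto its image and, for all $a,b,x\in\mathbb T$, $|a-x|\le|b-x|$ implies $|f(a)-f(x)|\le R\,|f(b)-f(x)|^t$. If $\Gamma\subset\mathbb R^2$ is a $t$-quasicircle, then there exist a constant $R$ and a weakly $(R,t)$-quasisymmetric map $f:\mathbb T\to\mathbb R^2$ such that $f(\mathbb T)=\Gamma$. -/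

import Mathlib

namespace TQuasi

/-- The Euclidean plane `ℝ²`. -/
abbrev Plane : Type := EuclideanSpace ℝ (Fin 2)

/-- A Jordan curve: a homeomorphic image of the unit circle in the plane
(a continuous injection of the compact circle is a homeomorphism onto its image). -/
def IsJordanCurve (Γ : Set Plane) : Prop :=
  ∃ γ : Circle → Plane, Continuous γ ∧ Function.Injective γ ∧ Set.range γ = Γ

/-- `A` is a subarc of `Γ` between `x` and `y`: a homeomorphic image of `[0,1]` inside `Γ`
whose endpoints are `x` and `y`. When `Γ` is a Jordan curve and `x ≠ y` are points of `Γ`,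
there are exactly two of them. -/
def IsSubarc (Γ : Set Plane) (x y : Plane) (A : Set Plane) : Prop :=
  A ⊆ Γ ∧ ∃ σ : unitInterval → Plane,
    Continuous σ ∧ Function.Injective σ ∧ σ 0 = x ∧ σ 1 = y ∧ Set.range σ = A

/-- `A` is a choice of `Γ(x,y)`: a subarc of `Γ` between `x` and `y` of smallest diameter
(either of the two subarcs when both have the same diameter). -/
def IsSmallerSubarc (Γ : Set Plane) (x y : Plane) (A : Set Plane) : Prop :=
  IsSubarc Γ x y A ∧ ∀ B : Set Plane, IsSubarc Γ x y B → Metric.diam A ≤ Metric.diam B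

/-- `Γ` is a `t`-quasicircle: a Jordan curve with `diam Γ(x,y) ≤ C |x - y| ^ t` for some
`C ≥ 1` and all `x, y ∈ Γ`. (For `x = y` the subarc degenerates to a point and the inequality
reads `0 ≤ 0`.) The exponent is meant to satisfy `0 < t ≤ 1`. -/
def IsTQuasicircle (t : ℝ) (Γ : Set Plane) : Prop :=
  IsJordanCurve Γ ∧ ∃ C : ℝ, 1 ≤ C ∧ ∀ x ∈ Γ, ∀ y ∈ Γ, x ≠ y →
    ∃ A : Set Plane, IsSmallerSubarc Γ x y A ∧ Metric.diam A ≤ C * dist x y ^ t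

/-- `f` is weakly `(R,t)`-quasisymmetric: it is a homeomorphism onto its image, and
`|a - x| ≤ |b - x|` implies `|f a - f x| ≤ R |f b - f x| ^ t`. -/
def IsWeaklyQuasisymmetric {X Y : Type*} [MetricSpace X] [MetricSpace Y]
    (R t : ℝ) (f : X → Y) : Prop :=
  Topology.IsEmbedding f ∧ ∀ a b x : X, dist a x ≤ dist b x →
    dist (f a) (f x) ≤ R * dist (f b) (f x) ^ t

end TQuasi

/-!
Let `g : ℝ → ℝ²` be the `1`-periodic parametrization of the Jordan curve obtained by unrolling the
circle, and let `W s u` be the diameter of the arc `g [s, u]`. Only a few properties of `W` matter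
(`ArcGauge`): it is monotone, subadditive, small on short intervals, positive on nondegenerate
intervals, and periodic.

Subdivide the curve as follows. An arc `[s, u]` of diameter `D` is cut at `a < b` so that both end
pieces `[s, a]` and `[b, u]` have diameter exactly `D / 3`; the middle piece then has diameter
between `D / 3` and `D`. Starting with the arcs `[i, i + 1]`, iterate. In parallel subdivide the
intervals `[i, i + 1]` of a second line into pieces of relative lengths `1/4, 1/2, 1/4`. Since the
end pieces take a fixed proportion of their parent, two adjacent cells of the same depth, whether
siblings or not, have diameters within a factor `3` and lengths within a factor `2`
(`IsCut.weight_comparable`). Both families of division points are dense (`IsCut.denseRange_node`):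
each time the cell of a given point is cut, it loses an end piece of diameter at least a fixed
proportion of its own, which uniform continuity permits only finitely often as long as the
diameters stay bounded below.

The order isomorphism `e : ℝ ≃o ℝ` matching the two families therefore exists. Comparing the
cell of `x` of length about `2 r` with the cells four levels further down gives
(`ArcGauge.exists_orderIso`)
`W (e (x - r)) (e (x + r)) ≤ 1701 * min (W (e (x - r)) (e x)) (W (e x) (e (x + r)))` for
`r ≤ 1 / 2`. No doubling property of the curve is involved.

The map `f` is `g ∘ e`, rolled up to the circle. If `|a - x| ≤ |b - x|` and `b = x ± r`, then
`|f a - f x|` is at most the diameter of the arc over `[x - r, x + r]`. On the other hand every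
subarc joining `f x` and `f b` contains one of the two arcs of the circle parametrization
(`subset_of_isPreconnected`), and both have diameter at least `1 / 1701` of that; the quasicircle
condition bounds the diameter of one such subarc by `C * |f b - f x| ^ t`.
-/

namespace TQuasi

/-! ### Gauges of intervals and ternary subdivisions -/

/-- A periodic size function for the intervals `[s, u]` of the line, `W s u` being the size of
`[s, u]`. Both the length and the diameter of the corresponding arc of a closed curve are
examples. The values `W s u` for `u < s` play no role. -/
structure ArcGauge (W : ℝ → ℝ → ℝ) : Prop where
  mono : ∀ {s' s u u' : ℝ}, s' ≤ s → s ≤ u → u ≤ u' → W s u ≤ W s' u'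
  subadd : ∀ {s v u : ℝ}, s ≤ v → v ≤ u → W s u ≤ W s v + W v u
  pos : ∀ {s u : ℝ}, s < u → 0 < W s u
  small : ∀ ε > 0, ∃ δ > 0, ∀ s u : ℝ, s ≤ u → u - s < δ → W s u < ε
  periodic : ∀ s u : ℝ, W (s + 1) (u + 1) = W s u

/-- The functions `a` and `b` cut every interval `[s, u]` at two interior points `a s u < b s u`,
compatibly with translation by `1`, in such a way that both end pieces have exactly the proportion
`c` of the size of `[s, u]`, and the middle piece has between `1` and `K` times the size of an
end piece. -/
structure IsCut (W : ℝ → ℝ → ℝ) (c K : ℝ) (a b : ℝ → ℝ → ℝ) : Prop where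
  left_lt : ∀ {s u : ℝ}, s < u → s < a s u
  mid_lt : ∀ {s u : ℝ}, s < u → a s u < b s u
  right_lt : ∀ {s u : ℝ}, s < u → b s u < u
  left_eq : ∀ {s u : ℝ}, s < u → W s (a s u) = c * W s u
  right_eq : ∀ {s u : ℝ}, s < u → W (b s u) u = c * W s u
  le_mid : ∀ {s u : ℝ}, s < u → c * W s u ≤ W (a s u) (b s u)
  mid_le : ∀ {s u : ℝ}, s < u → W (a s u) (b s u) ≤ K * (c * W s u)
  left_add_one : ∀ s u : ℝ, a (s + 1) (u + 1) = a s u + 1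
  right_add_one : ∀ s u : ℝ, b (s + 1) (u + 1) = b s u + 1

/-- The division points of the iterated ternary subdivision with cuts `a`, `b`. The points of depth
`k` are indexed by `ℤ` in increasing order; `[node a b k i, node a b k (i + 1)]` is the `i`-th cell
of depth `k`, with children `3 * i`, `3 * i + 1`, `3 * i + 2` at depth `k + 1`. The cells of depth
`0` are the intervals `[i, i + 1]`. -/
noncomputable def node (a b : ℝ → ℝ → ℝ) : ℕ → ℤ → ℝ
  | 0, i => i
  | k + 1, j =>
    if j % 3 = 0 then node a b k (j / 3)
    else if j % 3 = 1 then a (node a b k (j / 3)) (node a b k (j / 3 + 1))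
    else b (node a b k (j / 3)) (node a b k (j / 3 + 1))

section node

variable {W : ℝ → ℝ → ℝ} {c K : ℝ} {a b : ℝ → ℝ → ℝ}

lemma node_zero (i : ℤ) : node a b 0 i = i := rfl

lemma node_succ_three_mul (k : ℕ) (i : ℤ) : node a b (k + 1) (3 * i) = node a b k i := by
  have h1 : (3 * i) % 3 = 0 := by omega
  have h2 : (3 * i) / 3 = i := by omega
  simp [node, h1, h2]

lemma node_succ_three_mul_add_one (k : ℕ) (i : ℤ) :
    node a b (k + 1) (3 * i + 1) = a (node a b k i) (node a b k (i + 1)) := by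
  have h1 : (3 * i + 1) % 3 = 1 := by omega
  have h2 : (3 * i + 1) / 3 = i := by omega
  simp [node, h1, h2]

lemma node_succ_three_mul_add_two (k : ℕ) (i : ℤ) :
    node a b (k + 1) (3 * i + 2) = b (node a b k i) (node a b k (i + 1)) := by
  have h1 : (3 * i + 2) % 3 = 2 := by omega
  have h2 : (3 * i + 2) / 3 = i := by omega
  simp [node, h1, h2]

lemma node_succ_three_mul_add_three (k : ℕ) (i : ℤ) :
    node a b (k + 1) (3 * i + 3) = node a b k (i + 1) := by
  rw [show 3 * i + 3 = 3 * (i + 1) by ring, node_succ_three_mul]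

lemma exists_eq_three_mul_add (j : ℤ) : ∃ i : ℤ, j = 3 * i ∨ j = 3 * i + 1 ∨ j = 3 * i + 2 :=
  ⟨j / 3, by omega⟩

lemma IsCut.node_lt_succ (h : IsCut W c K a b) (k : ℕ) (j : ℤ) :
    node a b k j < node a b k (j + 1) := by
  induction k generalizing j with
  | zero => simp [node]
  | succ k ih =>
    obtain ⟨i, rfl | rfl | rfl⟩ := exists_eq_three_mul_add j
    · rw [node_succ_three_mul, node_succ_three_mul_add_one]
      exact h.left_lt (ih i)
    · rw [node_succ_three_mul_add_one, show 3 * i + 1 + 1 = 3 * i + 2 by ring,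
        node_succ_three_mul_add_two]
      exact h.mid_lt (ih i)
    · rw [node_succ_three_mul_add_two, show 3 * i + 2 + 1 = 3 * i + 3 by ring,
        node_succ_three_mul_add_three]
      exact h.right_lt (ih i)

lemma IsCut.node_strictMono (h : IsCut W c K a b) (k : ℕ) : StrictMono (node a b k) :=
  strictMono_int_of_lt_succ (h.node_lt_succ k)

lemma node_add_three_pow_mul (k l : ℕ) (i : ℤ) : node a b (k + l) (3 ^ l * i) = node a b k i := by
  induction l with
  | zero => simp
  | succ l ih => rw [← ih, ← add_assoc, pow_succ', mul_assoc, node_succ_three_mul]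

/-- The order of the division points does not depend on the cuts. -/
lemma IsCut.node_le_node_iff (h : IsCut W c K a b) (k l : ℕ) (i j : ℤ) :
    node a b k i ≤ node a b l j ↔ 3 ^ l * i ≤ 3 ^ k * j := by
  rw [← node_add_three_pow_mul k l i, ← node_add_three_pow_mul l k j, add_comm l k,
    (h.node_strictMono _).le_iff_le]

lemma IsCut.node_add_three_pow (h : IsCut W c K a b) (k : ℕ) (i : ℤ) :
    node a b k (i + 3 ^ k) = node a b k i + 1 := by
  induction k generalizing i with
  | zero => simp [node]
  | succ k ih =>
    obtain ⟨i, rfl | rfl | rfl⟩ := exists_eq_three_mul_add i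
    · rw [show 3 * i + 3 ^ (k + 1) = 3 * (i + 3 ^ k) by ring, node_succ_three_mul,
        node_succ_three_mul, ih]
    · rw [show 3 * i + 1 + 3 ^ (k + 1) = 3 * (i + 3 ^ k) + 1 by ring,
        node_succ_three_mul_add_one, node_succ_three_mul_add_one, add_right_comm, ih, ih,
        h.left_add_one]
    · rw [show 3 * i + 2 + 3 ^ (k + 1) = 3 * (i + 3 ^ k) + 2 by ring,
        node_succ_three_mul_add_two, node_succ_three_mul_add_two, add_right_comm, ih, ih,
        h.right_add_one]

/-- Adjacent cells of the same depth have sizes within a factor `K`, uniformly in the depth: for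
siblings this is the definition of a cut, and for adjacent cells with different parents the ratio is
that of the parents, as both are end pieces. -/
lemma IsCut.weight_comparable (h : IsCut W c K a b) (hW : ArcGauge W) (hc : 0 < c) (hK : 1 ≤ K)
    (k : ℕ) (j : ℤ) :
    W (node a b k j) (node a b k (j + 1)) ≤ K * W (node a b k (j + 1)) (node a b k (j + 2)) ∧
      W (node a b k (j + 1)) (node a b k (j + 2)) ≤ K * W (node a b k j) (node a b k (j + 1)) := by
  induction k generalizing j with
  | zero =>
    have h1 : W (j + 1 : ℝ) (j + 2) = W j (j + 1) := by
      rw [← hW.periodic j (j + 1)]; congr 1; ring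
    have h2 : 0 < W (j : ℝ) (j + 1) := hW.pos (by linarith)
    simp only [node]
    push_cast
    rw [h1]
    constructor <;> nlinarith
  | succ k ih =>
    obtain ⟨i, rfl | rfl | rfl⟩ := exists_eq_three_mul_add j
    · have hi := h.node_lt_succ k i
      have hp := mul_pos hc (hW.pos hi)
      rw [node_succ_three_mul, node_succ_three_mul_add_one, node_succ_three_mul_add_two,
        h.left_eq hi]
      exact ⟨by nlinarith [h.le_mid hi], h.mid_le hi⟩
    · have hi := h.node_lt_succ k i
      have hp := mul_pos hc (hW.pos hi)
      rw [show 3 * i + 1 + 1 = 3 * i + 2 by ring, show 3 * i + 1 + 2 = 3 * i + 3 by ring,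
        node_succ_three_mul_add_one, node_succ_three_mul_add_two, node_succ_three_mul_add_three,
        h.right_eq hi]
      exact ⟨h.mid_le hi, by nlinarith [h.le_mid hi]⟩
    · have hi := h.node_lt_succ k i
      have hi' := h.node_lt_succ k (i + 1)
      rw [show 3 * i + 2 + 1 = 3 * i + 3 by ring, show 3 * i + 2 + 2 = 3 * (i + 1) + 1 by ring,
        node_succ_three_mul_add_two, node_succ_three_mul_add_three, node_succ_three_mul_add_one,
        h.right_eq hi, h.left_eq hi']
      obtain ⟨h1, h2⟩ := ih i
      rw [show i + 2 = i + 1 + 1 by ring] at h1 h2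
      constructor <;> nlinarith

/-- Every point lies in a nested sequence of cells, one of each depth `k`, with index `n k`. -/
lemma IsCut.exists_cell (h : IsCut W c K a b) (x : ℝ) : ∃ n : ℕ → ℤ,
    (∀ k, node a b k (n k) ≤ x ∧ x < node a b k (n k + 1)) ∧
    ∀ k, n (k + 1) = 3 * n k ∨ n (k + 1) = 3 * n k + 1 ∨ n (k + 1) = 3 * n k + 2 := by
  have key : ∀ k, ∃ i : ℤ, node a b k i ≤ x ∧ x < node a b k (i + 1) := by
    intro k
    induction k with
    | zero => exact ⟨⌊x⌋, by simpa [node] using Int.floor_le x, by simp [node]⟩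
    | succ k ih =>
      obtain ⟨i, hi, hi'⟩ := ih
      rw [← node_succ_three_mul] at hi
      rw [← node_succ_three_mul_add_three] at hi'
      by_cases h1 : x < node a b (k + 1) (3 * i + 1)
      · exact ⟨_, hi, h1⟩
      by_cases h2 : x < node a b (k + 1) (3 * i + 2)
      · exact ⟨_, not_lt.1 h1, by rwa [show 3 * i + 1 + 1 = 3 * i + 2 by ring]⟩
      · exact ⟨_, not_lt.1 h2, by rwa [show 3 * i + 2 + 1 = 3 * i + 3 by ring]⟩
  choose n hn using key
  refine ⟨n, hn, fun k => ?_⟩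
  obtain ⟨h1, h2⟩ := hn k
  obtain ⟨h3, h4⟩ := hn (k + 1)
  rw [← node_succ_three_mul] at h1
  rw [← node_succ_three_mul_add_three] at h2
  have h5 := (h.node_strictMono (k + 1)).lt_iff_lt.1 (h1.trans_lt h4)
  have h6 := (h.node_strictMono (k + 1)).lt_iff_lt.1 (h3.trans_lt h2)
  omega

lemma IsCut.le_weight_child (h : IsCut W c K a b) {k : ℕ} {i j : ℤ}
    (hj : j = 3 * i ∨ j = 3 * i + 1 ∨ j = 3 * i + 2) :
    c * W (node a b k i) (node a b k (i + 1)) ≤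
      W (node a b (k + 1) j) (node a b (k + 1) (j + 1)) := by
  have hi := h.node_lt_succ k i
  obtain rfl | rfl | rfl := hj
  · rw [node_succ_three_mul, node_succ_three_mul_add_one, h.left_eq hi]
  · rw [node_succ_three_mul_add_one, show 3 * i + 1 + 1 = 3 * i + 2 by ring,
      node_succ_three_mul_add_two]
    exact h.le_mid hi
  · rw [node_succ_three_mul_add_two, show 3 * i + 2 + 1 = 3 * i + 3 by ring,
      node_succ_three_mul_add_three, h.right_eq hi]

lemma IsCut.weight_child_le (h : IsCut W c K a b) (hW : ArcGauge W) (hc : 0 < c) (hK : 1 ≤ K)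
    {k : ℕ} {i j : ℤ} (hj : j = 3 * i ∨ j = 3 * i + 1 ∨ j = 3 * i + 2) :
    W (node a b (k + 1) j) (node a b (k + 1) (j + 1)) ≤
      K * (c * W (node a b k i) (node a b k (i + 1))) := by
  have hi := h.node_lt_succ k i
  have hp := mul_pos hc (hW.pos hi)
  obtain rfl | rfl | rfl := hj
  · rw [node_succ_three_mul, node_succ_three_mul_add_one, h.left_eq hi]
    nlinarith
  · rw [node_succ_three_mul_add_one, show 3 * i + 1 + 1 = 3 * i + 2 by ring,
      node_succ_three_mul_add_two]
    exact h.mid_le hi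
  · rw [node_succ_three_mul_add_two, show 3 * i + 2 + 1 = 3 * i + 3 by ring,
      node_succ_three_mul_add_three, h.right_eq hi]
    nlinarith

/-- The sizes along a nested sequence of cells become arbitrarily small: otherwise each step would
remove an end piece of size bounded below, hence of length bounded below. -/
lemma IsCut.exists_weight_cell_lt (h : IsCut W c K a b) (hW : ArcGauge W) (hc : 0 < c)
    {n : ℕ → ℤ}
    (hn : ∀ k, n (k + 1) = 3 * n k ∨ n (k + 1) = 3 * n k + 1 ∨ n (k + 1) = 3 * n k + 2)
    {ε : ℝ} (hε : 0 < ε) :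
    ∃ k, W (node a b k (n k)) (node a b k (n k + 1)) < ε := by
  by_contra! hcon
  obtain ⟨η, hη, hs⟩ := hW.small (c * ε) (by positivity)
  have big : ∀ {s u : ℝ}, s ≤ u → c * ε ≤ W s u → η ≤ u - s := fun {s u} hsu hw => by
    by_contra! hlt
    exact absurd (hs s u hsu hlt) (not_lt.2 hw)
  have step : ∀ k : ℕ, node a b k (n k + 1) - node a b k (n k) ≤
      (node a b 0 (n 0 + 1) - node a b 0 (n 0)) - k * η := by
    intro k
    induction k with
    | zero => simp
    | succ k ih =>
      have hi := h.node_lt_succ k (n k)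
      have hle : c * ε ≤ c * W (node a b k (n k)) (node a b k (n k + 1)) :=
        mul_le_mul_of_nonneg_left (hcon k) hc.le
      have h1 := big (h.left_lt hi).le (by rw [h.left_eq hi]; exact hle)
      have h2 := big (h.right_lt hi).le (by rw [h.right_eq hi]; exact hle)
      have h3 := h.left_lt hi
      have h4 := h.mid_lt hi
      have h5 := h.right_lt hi
      push_cast
      obtain hk | hk | hk := hn k
      · rw [hk, node_succ_three_mul, node_succ_three_mul_add_one]
        linarith
      · rw [hk, node_succ_three_mul_add_one, show 3 * n k + 1 + 1 = 3 * n k + 2 by ring,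
          node_succ_three_mul_add_two]
        linarith
      · rw [hk, node_succ_three_mul_add_two, show 3 * n k + 2 + 1 = 3 * n k + 3 by ring,
          node_succ_three_mul_add_three]
        linarith
  obtain ⟨k, hk⟩ := exists_nat_gt ((node a b 0 (n 0 + 1) - node a b 0 (n 0)) / η)
  rw [div_lt_iff₀ hη] at hk
  linarith [step k, h.node_lt_succ k (n k)]

lemma IsCut.denseRange_node (h : IsCut W c K a b) (hW : ArcGauge W) (hc : 0 < c) :
    DenseRange fun x : ℕ × ℤ => node a b x.1 x.2 := by
  refine dense_of_exists_between fun y z hyz => ?_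
  obtain ⟨x, hyx, hxz⟩ := exists_between hyz
  obtain ⟨n, hx, hn⟩ := h.exists_cell x
  obtain ⟨k, hk⟩ := h.exists_weight_cell_lt hW hc hn (hW.pos hyx)
  refine ⟨_, ⟨(k, n k), rfl⟩, ?_, (hx k).1.trans_lt hxz⟩
  by_contra! hle
  exact absurd (hW.mono hle hyx.le (hx k).2.le) (not_le.2 hk)

end node

/-! ### Extension of a monotone correspondence of dense sets -/

/-- Two dense families of reals indexed by the same set and ordered in the same way are matched by
an order automorphism of the line. -/
theorem exists_orderIso_of_denseRange {ι : Type*} {p q : ι → ℝ} (hp : DenseRange p)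
    (hq : DenseRange q) (hpq : ∀ i j, p i ≤ p j ↔ q i ≤ q j) :
    ∃ e : ℝ ≃o ℝ, ∀ i, e (q i) = p i := by
  have hlt : ∀ i j, p i < p j ↔ q i < q j := fun i j => by
    rw [← not_le, ← not_le, hpq]
  have bp : ∀ {y z : ℝ}, y < z → ∃ i, y < p i ∧ p i < z := fun hyz => by
    obtain ⟨_, ⟨i, rfl⟩, hi⟩ := hp.exists_between hyz
    exact ⟨i, hi⟩
  have bq : ∀ {y z : ℝ}, y < z → ∃ i, y < q i ∧ q i < z := fun hyz => by
    obtain ⟨_, ⟨i, rfl⟩, hi⟩ := hq.exists_between hyz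
    exact ⟨i, hi⟩
  let φ : ℝ → ℝ := fun x => sSup (p '' {i | q i ≤ x})
  have hbdd : ∀ x, BddAbove (p '' {i | q i ≤ x}) := fun x => by
    obtain ⟨j, hj, -⟩ := bq (lt_add_one x)
    refine ⟨p j, ?_⟩
    rintro _ ⟨i, hi, rfl⟩
    exact (hpq i j).2 (hi.trans hj.le)
  have hne : ∀ x, (p '' {i | q i ≤ x}).Nonempty := fun x => by
    obtain ⟨j, -, hj⟩ := bq (sub_one_lt x)
    exact ⟨p j, j, hj.le, rfl⟩
  have hφ : ∀ i, φ (q i) = p i := fun i => by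
    refine IsGreatest.csSup_eq ⟨⟨i, le_refl (q i), rfl⟩, ?_⟩
    rintro _ ⟨j, hj, rfl⟩
    exact (hpq j i).2 hj
  have hmono : Monotone φ := fun x y hxy =>
    csSup_le_csSup (hbdd y) (hne x) (Set.image_mono fun i hi => le_trans hi hxy)
  have hstrict : StrictMono φ := fun x y hxy => by
    obtain ⟨i, hxi, hiy⟩ := bq hxy
    obtain ⟨j, hij, hjy⟩ := bq hiy
    calc φ x ≤ φ (q i) := hmono hxi.le
      _ < φ (q j) := by rw [hφ, hφ]; exact (hlt i j).2 hij
      _ ≤ φ y := hmono hjy.le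
  have hsurj : Function.Surjective φ := fun y => by
    have hb : BddAbove (q '' {i | p i ≤ y}) := by
      obtain ⟨j, hj, -⟩ := bp (lt_add_one y)
      refine ⟨q j, ?_⟩
      rintro _ ⟨i, hi, rfl⟩
      exact (hpq i j).1 (le_trans hi hj.le)
    have hn : (q '' {i | p i ≤ y}).Nonempty := by
      obtain ⟨j, -, hj⟩ := bp (sub_one_lt y)
      exact ⟨q j, j, hj.le, rfl⟩
    refine ⟨sSup (q '' {i | p i ≤ y}), le_antisymm ?_ ?_⟩
    · by_contra! hlt'
      obtain ⟨i, h1, h2⟩ := bp hlt'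
      refine absurd (hmono (csSup_le hn ?_ : _ ≤ q i)) (by rw [hφ]; exact not_le.2 h2)
      rintro _ ⟨j, hj, rfl⟩
      exact (hpq j i).1 (le_trans hj h1.le)
    · by_contra! hlt'
      obtain ⟨i, h1, h2⟩ := bp hlt'
      exact absurd (hmono (le_csSup hb ⟨i, h2.le, rfl⟩)) (by rw [hφ]; exact not_le.2 h1)
  exact ⟨hstrict.orderIsoOfSurjective φ hsurj, hφ⟩

/-! ### Cutting an interval into pieces of prescribed size -/

lemma ArcGauge.self_eq_zero {W : ℝ → ℝ → ℝ} (hW : ArcGauge W) (s : ℝ) : W s s = 0 := by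
  refine le_antisymm (le_of_forall_pos_lt_add fun ε hε => ?_) ?_
  · obtain ⟨δ, hδ, h⟩ := hW.small ε hε
    simpa using h s s le_rfl (by simpa using hδ)
  · linarith [hW.subadd (le_refl s) (le_refl s)]

lemma ArcGauge.continuousOn_right {W : ℝ → ℝ → ℝ} (hW : ArcGauge W) (s u : ℝ) :
    ContinuousOn (fun v => W s v) (Set.Icc s u) := by
  rw [Metric.continuousOn_iff]
  intro v hv ε hε
  obtain ⟨δ, hδ, h⟩ := hW.small ε hε
  refine ⟨δ, hδ, fun w hw hd => ?_⟩
  rw [Real.dist_eq, abs_lt] at *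
  obtain hle | hle := le_total v w
  · have h1 := h v w hle hd.2
    have h2 := hW.subadd hv.1 hle
    have h3 := hW.mono (le_refl s) hv.1 hle
    constructor <;> linarith
  · have h1 := h w v hle (by linarith)
    have h2 := hW.subadd hw.1 hle
    have h3 := hW.mono (le_refl s) hw.1 hle
    constructor <;> linarith

lemma ArcGauge.continuousOn_left {W : ℝ → ℝ → ℝ} (hW : ArcGauge W) (s u : ℝ) :
    ContinuousOn (fun v => W v u) (Set.Icc s u) := by
  rw [Metric.continuousOn_iff]
  intro v hv ε hε
  obtain ⟨δ, hδ, h⟩ := hW.small ε hε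
  refine ⟨δ, hδ, fun w hw hd => ?_⟩
  rw [Real.dist_eq, abs_lt] at *
  obtain hle | hle := le_total v w
  · have h1 := h v w hle hd.2
    have h2 := hW.subadd hle hw.2
    have h3 := hW.mono hle hw.2 (le_refl u)
    constructor <;> linarith
  · have h1 := h w v hle (by linarith)
    have h2 := hW.subadd hle hv.2
    have h3 := hW.mono hle hv.2 (le_refl u)
    constructor <;> linarith

lemma ArcGauge.exists_cut_points {W : ℝ → ℝ → ℝ} (hW : ArcGauge W) {s u : ℝ} (hsu : s < u) :
    ∃ a b, s < a ∧ a < b ∧ b < u ∧ W s a = 1 / 3 * W s u ∧ W b u = 1 / 3 * W s u ∧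
      1 / 3 * W s u ≤ W a b ∧ W a b ≤ 3 * (1 / 3 * W s u) := by
  have hpos := hW.pos hsu
  obtain ⟨a, ⟨hsa, hau⟩, ha⟩ := intermediate_value_Icc hsu.le (hW.continuousOn_right s u)
    (show 1 / 3 * W s u ∈ Set.Icc (W s s) (W s u) by
      rw [hW.self_eq_zero]; constructor <;> linarith)
  obtain ⟨b, ⟨hsb, hbu⟩, hb⟩ := intermediate_value_Icc' hsu.le (hW.continuousOn_left s u)
    (show 1 / 3 * W s u ∈ Set.Icc (W u u) (W s u) by
      rw [hW.self_eq_zero]; constructor <;> linarith)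
  simp only at ha hb
  have hab : a < b := by
    by_contra! hle
    linarith [hW.subadd hsb hbu, hW.mono (le_refl s) hsb hle]
  have h1 := hW.subadd hsa hau
  have h2 := hW.subadd hab.le hbu
  have h3 := hW.mono hsa hab.le hbu
  refine ⟨a, b, lt_of_le_of_ne hsa ?_, hab, lt_of_le_of_ne hbu ?_, ha, hb, by linarith,
    by linarith⟩
  · rintro rfl
    rw [hW.self_eq_zero] at ha
    linarith
  · rintro rfl
    rw [hW.self_eq_zero] at hb
    linarith

lemma ArcGauge.add_int {W : ℝ → ℝ → ℝ} (hW : ArcGauge W) (s u : ℝ) (n : ℤ) :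
    W (s + n) (u + n) = W s u := by
  induction n with
  | zero => simp
  | succ n ih =>
    rw [← ih, ← hW.periodic (s + (n : ℤ)) (u + (n : ℤ))]
    push_cast
    congr 1 <;> ring
  | pred n ih =>
    rw [← ih, ← hW.periodic]
    push_cast
    congr 1 <;> ring

/-- Every gauge admits cuts with end pieces of one third of the total size. -/
theorem ArcGauge.exists_isCut {W : ℝ → ℝ → ℝ} (hW : ArcGauge W) :
    ∃ a b : ℝ → ℝ → ℝ, IsCut W (1 / 3) 3 a b := by
  -- The cuts are chosen for intervals starting in `[0, 1)` and transported by integer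
  -- translations, which makes them compatible with translation by `1`.
  choose! a b h using fun s u (hsu : s < u) => hW.exists_cut_points hsu
  have key : ∀ {s u : ℝ}, s < u →
      let a' := a (s - ⌊s⌋) (u - ⌊s⌋) + ⌊s⌋
      let b' := b (s - ⌊s⌋) (u - ⌊s⌋) + ⌊s⌋
      s < a' ∧ a' < b' ∧ b' < u ∧ W s a' = 1 / 3 * W s u ∧ W b' u = 1 / 3 * W s u ∧
      1 / 3 * W s u ≤ W a' b' ∧ W a' b' ≤ 3 * (1 / 3 * W s u) := fun {s u} hsu => by
    obtain ⟨h1, h2, h3, h4, h5, h6, h7⟩ := h (s - ⌊s⌋) (u - ⌊s⌋) (by linarith)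
    have e1 := hW.add_int (s - ⌊s⌋) (u - ⌊s⌋) ⌊s⌋
    have e2 := hW.add_int (s - ⌊s⌋) (a (s - ⌊s⌋) (u - ⌊s⌋)) ⌊s⌋
    have e3 := hW.add_int (b (s - ⌊s⌋) (u - ⌊s⌋)) (u - ⌊s⌋) ⌊s⌋
    have e4 := hW.add_int (a (s - ⌊s⌋) (u - ⌊s⌋)) (b (s - ⌊s⌋) (u - ⌊s⌋)) ⌊s⌋
    rw [sub_add_cancel] at e1 e2 e3
    rw [sub_add_cancel] at e1
    rw [← e1, ← e2] at h4
    rw [← e1, ← e3] at h5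
    rw [← e1, ← e4] at h6 h7
    exact ⟨by linarith, by linarith, by linarith, h4, h5, h6, h7⟩
  refine ⟨fun s u => a (s - ⌊s⌋) (u - ⌊s⌋) + ⌊s⌋, fun s u => b (s - ⌊s⌋) (u - ⌊s⌋) + ⌊s⌋,
    fun h => (key h).1, fun h => (key h).2.1, fun h => (key h).2.2.1, fun h => (key h).2.2.2.1,
    fun h => (key h).2.2.2.2.1, fun h => (key h).2.2.2.2.2.1, fun h => (key h).2.2.2.2.2.2,
    fun s u => ?_, fun s u => ?_⟩ <;>
  · simp only [Int.floor_add_one]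
    push_cast
    rw [add_sub_add_right_eq_sub, add_sub_add_right_eq_sub, add_assoc]

/-! ### The doubling parametrization -/

lemma arcGauge_length : ArcGauge fun s u => u - s where
  mono := by intros; linarith
  subadd := by intros; linarith
  pos := by intros; linarith
  small := fun ε hε => ⟨ε, hε, fun _ _ _ h => h⟩
  periodic := by intros; ring

lemma isCut_length : IsCut (fun s u => u - s) (1 / 4) 2
    (fun s u => s + (u - s) / 4) (fun s u => u - (u - s) / 4) := by
  constructor <;> intros <;> linarith

/-- Every gauge can be reparametrized so that each half of a symmetric interval of length at most
`1` has a definite proportion of the size of the whole interval. The constant is `7 * 3 ^ 5`: the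
interval lies in three adjacent cells of size at most `D`, `3 * D`, `3 * D`, and each half contains
a cell adjacent to a descendant, four levels down, of the cell of size `D`. -/
theorem ArcGauge.exists_orderIso {W : ℝ → ℝ → ℝ} (hW : ArcGauge W) :
    ∃ e : ℝ ≃o ℝ, (∀ x, e (x + 1) = e x + 1) ∧ ∀ x r : ℝ, 0 < r → 2 * r ≤ 1 →
      W (e (x - r)) (e (x + r)) ≤ 1701 * W (e x) (e (x + r)) ∧
      W (e (x - r)) (e (x + r)) ≤ 1701 * W (e (x - r)) (e x) := by
  obtain ⟨a, b, hp⟩ := hW.exists_isCut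
  have hL := arcGauge_length
  have hq := isCut_length
  set p := node a b with hpdef
  set q := node (fun s u => s + (u - s) / 4) (fun s u => u - (u - s) / 4) with hqdef
  have dq : DenseRange fun x : ℕ × ℤ => q x.1 x.2 := hq.denseRange_node hL (by norm_num)
  obtain ⟨e, he'⟩ := exists_orderIso_of_denseRange (hp.denseRange_node hW (by norm_num)) dq
    fun i j => by rw [hp.node_le_node_iff, hq.node_le_node_iff]
  have he : ∀ k i, e (q k i) = p k i := fun k i => he' (k, i)
  refine ⟨e, fun x => ?_, fun x r hr hr2 => ?_⟩
  · refine congrFun (dq.equalizer (g := fun x => e (x + 1)) (h := fun x => e x + 1)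
      (e.continuous.comp (continuous_add_const 1)) (e.continuous.add_const 1) ?_) x
    funext ⟨k, i⟩
    simp only [Function.comp]
    rw [he, hpdef, ← hp.node_add_three_pow, ← hpdef, ← he, hqdef, hq.node_add_three_pow]
  obtain ⟨n, hx, hn⟩ := hq.exists_cell x
  have hpn : ∀ k, p k (n k) < p k (n k + 1) := fun k => hp.node_lt_succ k _
  have half : ∀ k, q (k + 1) (n (k + 1) + 1) - q (k + 1) (n (k + 1)) ≤
      (q k (n k + 1) - q k (n k)) / 2 := fun k => by
    have h1 := hq.weight_child_le hL (by norm_num) (by norm_num) (k := k) (hn k)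
    simp only [hqdef]
    linarith
  have third : ∀ k, W (p k (n k)) (p k (n k + 1)) ≤
      3 * W (p (k + 1) (n (k + 1))) (p (k + 1) (n (k + 1) + 1)) := fun k => by
    have h1 := hp.le_weight_child (k := k) (hn k)
    simp only [hpdef]
    linarith
  have hex : ∃ k, q k (n k + 1) - q k (n k) < 2 * r :=
    hq.exists_weight_cell_lt hL (by norm_num) hn (by positivity)
  classical
  -- `m` is the last depth at which the cell of `x` has length at least `2 * r`; the cells next to
  -- it then have length at least `r`.
  obtain ⟨m, hm, hm'⟩ : ∃ m, 2 * r ≤ q m (n m + 1) - q m (n m) ∧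
      q (m + 1) (n (m + 1) + 1) - q (m + 1) (n (m + 1)) < 2 * r := by
    have h0 : Nat.find hex ≠ 0 := by
      intro h0
      have := Nat.find_spec hex
      rw [h0, hqdef, node_zero, node_zero] at this
      push_cast at this
      linarith
    obtain ⟨m, hm⟩ := Nat.exists_eq_succ_of_ne_zero h0
    refine ⟨m, ?_, ?_⟩
    · exact not_lt.1 (Nat.find_min hex (m := m) (by omega))
    · have := Nat.find_spec hex
      rwa [hm] at this
  have cq := fun k j => hq.weight_comparable hL (by norm_num) (by norm_num) k j
  have cp := fun k j => hp.weight_comparable hW (by norm_num) (by norm_num) k j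
  rw [← hqdef] at cq hx
  rw [← hpdef] at cp
  have upper : W (e (x - r)) (e (x + r)) ≤ 7 * W (p m (n m)) (p m (n m + 1)) := by
    have h1 := (cq m (n m - 1)).2
    have h2 := (cq m (n m)).1
    have h3 := (cp m (n m - 1)).1
    have h4 := (cp m (n m)).2
    rw [sub_add_cancel, show n m - 1 + 2 = n m + 1 by ring] at h1 h3
    have h5 := hW.mono (s' := p m (n m - 1)) (u' := p m (n m + 2)) (s := e (x - r))
      (u := e (x + r)) (by rw [← he, e.le_iff_le]; linarith [(hx m).1])
      (by rw [e.le_iff_le]; linarith) (by rw [← he, e.le_iff_le]; linarith [(hx m).2])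
    have m1 : p m (n m - 1) ≤ p m (n m) := (hp.node_strictMono m).monotone (by omega)
    have m2 : p m (n m + 1) ≤ p m (n m + 2) := (hp.node_strictMono m).monotone (by omega)
    have h6 := hW.subadd m1 ((hpn m).le.trans m2)
    have h7 := hW.subadd (hpn m).le m2
    linarith
  have t0 := third m
  have t1 := third (m + 1)
  have t2 := third (m + 2)
  have t3 := third (m + 3)
  have l1 := half (m + 1)
  have l2 := half (m + 2)
  have l3 := half (m + 3)
  simp only [add_assoc, Nat.reduceAdd] at t0 t1 t2 t3 l1 l2 l3
  -- At depth `m + 4` the cell of `x` has length less than `r / 4` and its neighbours less than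
  -- `r / 2`, so these neighbours lie within distance `r` of `x`.
  generalize m + 4 = k at *
  have r1 := (cq k (n k - 1)).1
  have r2 := (cq k (n k)).2
  have r3 := (cp k (n k - 1)).2
  have r4 := (cp k (n k)).1
  rw [sub_add_cancel, show n k - 1 + 2 = n k + 1 by ring] at r1 r3
  have m1 : p k (n k - 1) ≤ p k (n k) := (hp.node_strictMono k).monotone (by omega)
  have m2 : p k (n k + 1) ≤ p k (n k + 2) := (hp.node_strictMono k).monotone (by omega)
  obtain ⟨x1, x2⟩ := hx k
  constructor
  · have := hW.mono (s' := e x) (u' := e (x + r)) (s := p k (n k + 1)) (u := p k (n k + 2))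
      (by rw [← he, e.le_iff_le]; exact x2.le) m2 (by rw [← he, e.le_iff_le]; linarith)
    linarith
  · have := hW.mono (s' := e (x - r)) (u' := e x) (s := p k (n k - 1)) (u := p k (n k))
      (by rw [← he, e.le_iff_le]; linarith) m1 (by rw [← he, e.le_iff_le]; exact x1)
    linarith

/-! ### Unrolling the circle -/

/-- The universal covering of the circle by the line, normalized to have period `1`. -/
noncomputable def unroll (x : ℝ) : Circle := Circle.exp (2 * Real.pi * x)

lemma unroll_eq_unroll_iff {x y : ℝ} : unroll x = unroll y ↔ ∃ n : ℤ, x = y + n := by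
  rw [unroll, unroll, Circle.exp_eq_exp]
  have := Real.pi_pos
  refine exists_congr fun n => ⟨fun h => ?_, fun h => by rw [h]; ring⟩
  have : 2 * Real.pi * (x - (y + n)) = 0 := by linarith
  rcases mul_eq_zero.1 this with h | h <;> linarith

lemma unroll_add_one (x : ℝ) : unroll (x + 1) = unroll x :=
  unroll_eq_unroll_iff.2 ⟨1, by simp⟩

lemma continuous_unroll : Continuous unroll :=
  Circle.exp.continuous.comp (continuous_const.mul continuous_id)

lemma isOpenMap_unroll : IsOpenMap unroll :=
  isLocalHomeomorph_circleExp.isOpenMap.comp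
    (Homeomorph.mulLeft₀ (2 * Real.pi) (by positivity)).isOpenMap

lemma exists_unroll_eq (x : ℝ) (z : Circle) : ∃ y, unroll y = z ∧ |y - x| ≤ 1 / 2 := by
  obtain ⟨w, rfl⟩ := Circle.exp_surjective z
  have hpi := Real.pi_pos
  refine ⟨w / (2 * Real.pi) - round (w / (2 * Real.pi) - x), ?_, ?_⟩
  · rw [unroll, Circle.exp_eq_exp]
    refine ⟨-round (w / (2 * Real.pi) - x), ?_⟩
    push_cast
    field_simp
    ring
  · have := abs_sub_round (w / (2 * Real.pi) - x)
    rwa [sub_right_comm]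

lemma dist_unroll (x y : ℝ) : dist (unroll x) (unroll y) = 2 * |Real.sin (Real.pi * (x - y))| := by
  have h : (unroll x : ℂ) - unroll y =
      unroll y * (Complex.exp (Complex.I * ((2 * Real.pi * (x - y) : ℝ) : ℂ)) - 1) := by
    rw [mul_sub, mul_one, unroll, unroll, Circle.coe_exp, Circle.coe_exp, ← Complex.exp_add]
    congr 2
    push_cast
    ring
  change dist (unroll x : ℂ) (unroll y) = _
  rw [dist_eq_norm, h, norm_mul, Circle.norm_coe, one_mul,
    Complex.norm_exp_I_mul_ofReal_sub_one, norm_mul, Real.norm_eq_abs, Real.norm_eq_abs, abs_two]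
  congr 3
  ring

lemma dist_unroll_le (x y : ℝ) : dist (unroll x) (unroll y) ≤ 2 * Real.pi * |x - y| := by
  rw [dist_unroll]
  have h : |Real.sin (Real.pi * (x - y))| ≤ |Real.pi * (x - y)| := Real.abs_sin_le_abs
  rw [abs_mul, abs_of_pos Real.pi_pos] at h
  linarith

lemma abs_sub_le_of_dist_unroll_le {x y z : ℝ} (hy : |y - x| ≤ 1 / 2) (hz : |z - x| ≤ 1 / 2)
    (h : dist (unroll y) (unroll x) ≤ dist (unroll z) (unroll x)) : |y - x| ≤ |z - x| := by
  have hpi := Real.pi_pos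
  have key : ∀ w : ℝ, |w| ≤ 1 / 2 → |Real.sin (Real.pi * w)| = Real.sin (Real.pi * |w|) :=
    fun w hw => by
      have h0 := abs_nonneg w
      rw [← abs_of_pos hpi, ← abs_mul, abs_of_pos hpi, Real.abs_sin_eq_sin_abs_of_abs_le_pi]
      rw [abs_mul, abs_of_pos hpi]
      nlinarith
  rw [dist_unroll, dist_unroll, key _ hy, key _ hz] at h
  by_contra! hlt
  have := Real.sin_lt_sin_of_lt_of_le_pi_div_two (x := Real.pi * |z - x|) (y := Real.pi * |y - x|)
    (by nlinarith [abs_nonneg (z - x)]) (by nlinarith) (by nlinarith)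
  linarith

/-! ### Arcs of the curve -/

/-- A connected part of a Jordan curve containing two of its points contains one of the two arcs
between them: if it missed a point of each, these two points would disconnect it. -/
lemma subset_of_isPreconnected {γ : Circle → Plane} (hγ : Continuous γ)
    (hinj : Function.Injective γ) {A : Set Plane} (hA : A ⊆ Set.range γ) (hc : IsPreconnected A)
    {s u : ℝ} (hsu : s < u) (hus : u < s + 1) (hs : γ (unroll s) ∈ A) (hu : γ (unroll u) ∈ A) :
    (fun v => γ (unroll v)) '' Set.Icc s u ⊆ A ∨
      (fun v => γ (unroll v)) '' Set.Icc u (s + 1) ⊆ A := by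
  have hT : IsPreconnected (γ ⁻¹' A) := by
    rw [← (hγ.isClosedEmbedding hinj).isInducing.isPreconnected_image,
      Set.image_preimage_eq_of_subset hA]
    exact hc
  by_contra! hcon
  simp only [Set.not_subset] at hcon
  obtain ⟨⟨_, ⟨v, hv, rfl⟩, hvA⟩, ⟨_, ⟨w, hw, rfl⟩, hwA⟩⟩ := hcon
  have hsv : s < v := lt_of_le_of_ne hv.1 (by rintro rfl; exact hvA hs)
  have hvu : v < u := lt_of_le_of_ne hv.2 (by rintro rfl; exact hvA hu)
  have huw : u < w := lt_of_le_of_ne hw.1 (by rintro rfl; exact hwA hu)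
  have hws : w < s + 1 :=
    lt_of_le_of_ne hw.2 (by rintro rfl; simp only [unroll_add_one] at hwA; exact hwA hs)
  have cover : γ ⁻¹' A ⊆ unroll '' Set.Ioo v w ∪ unroll '' Set.Ioo w (v + 1) := by
    intro z hz
    obtain ⟨y, rfl, -⟩ := exists_unroll_eq 0 z
    set y' := y - ⌊y - v⌋ with hy'
    have hyy : unroll y' = unroll y := unroll_eq_unroll_iff.2 ⟨-⌊y - v⌋, by push_cast; ring⟩
    have h1 : v ≤ y' := by linarith [Int.floor_le (y - v)]
    have h2 : y' < v + 1 := by linarith [Int.lt_floor_add_one (y - v)]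
    rw [← hyy] at hz ⊢
    have h3 : v < y' := lt_of_le_of_ne h1 (by intro h; rw [← h] at hz; exact hvA hz)
    obtain h | h | h := lt_trichotomy y' w
    · exact Or.inl ⟨y', ⟨h3, h⟩, rfl⟩
    · rw [h] at hz
      exact absurd hz hwA
    · exact Or.inr ⟨y', ⟨h, h2⟩, rfl⟩
  obtain ⟨z, -, ⟨y₁, hy₁, rfl⟩, ⟨y₂, hy₂, h⟩⟩ := hT _ _ (isOpenMap_unroll _ isOpen_Ioo)
    (isOpenMap_unroll _ isOpen_Ioo) cover ⟨unroll u, hu, u, ⟨hvu, huw⟩, rfl⟩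
    ⟨unroll s, hs, s + 1, ⟨hws, by linarith⟩, unroll_add_one s⟩
  obtain ⟨n, hn⟩ := unroll_eq_unroll_iff.1 h
  have h1 : (0 : ℝ) < n := by linarith [hy₁.2, hy₂.1]
  have h2 : (n : ℝ) < 1 := by linarith [hy₁.1, hy₂.2]
  norm_cast at h1 h2
  omega

/-- The diameter of the arcs of a Jordan curve is a gauge. -/
lemma arcGauge_diam {γ : Circle → Plane} (hγ : Continuous γ) (hinj : Function.Injective γ) :
    ArcGauge fun s u => Metric.diam ((fun v => γ (unroll v)) '' Set.Icc s u) := by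
  have hcont : Continuous fun v => γ (unroll v) := hγ.comp continuous_unroll
  have hb : ∀ s u, Bornology.IsBounded ((fun v => γ (unroll v)) '' Set.Icc s u) :=
    fun s u => (isCompact_Icc.image hcont).isBounded
  refine ⟨fun h1 _ h2 => Metric.diam_mono (Set.image_mono (Set.Icc_subset_Icc h1 h2)) (hb _ _),
    fun {s v u} h1 h2 => ?_, fun {s u} h => ?_, fun ε hε => ?_, fun s u => ?_⟩
  · rw [← Set.Icc_union_Icc_eq_Icc h1 h2, Set.image_union]
    exact Metric.diam_union' ⟨_, ⟨v, ⟨h1, le_rfl⟩, rfl⟩, ⟨v, ⟨le_rfl, h2⟩, rfl⟩⟩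
  · have h1 : s < min u (s + 1 / 2) := lt_min h (by linarith)
    refine (dist_pos.2 ?_).trans_le (Metric.dist_le_diam_of_mem (hb s u)
      ⟨s, ⟨le_rfl, h.le⟩, rfl⟩ ⟨min u (s + 1 / 2), ⟨h1.le, min_le_left _ _⟩, rfl⟩)
    intro heq
    obtain ⟨n, hn⟩ := unroll_eq_unroll_iff.1 (hinj heq)
    have h2 := min_le_right u (s + 1 / 2)
    have h3 : (n : ℝ) < 0 := by linarith
    have h4 : (-1 : ℝ) < n := by linarith
    norm_cast at h3
    have h5 : (-1 : ℤ) < n := by exact_mod_cast h4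
    omega
  · obtain ⟨δ, hδ, h⟩ := Metric.uniformContinuous_iff.1
      (CompactSpace.uniformContinuous_of_continuous hγ) (ε / 2) (by positivity)
    have hpi := Real.pi_pos
    refine ⟨δ / (2 * Real.pi), by positivity, fun s u hsu hlt => ?_⟩
    rw [lt_div_iff₀ (by positivity)] at hlt
    refine (Metric.diam_le_of_forall_dist_le (C := ε / 2) (by positivity) ?_).trans_lt
      (by linarith)
    rintro _ ⟨v, hv, rfl⟩ _ ⟨w, hw, rfl⟩
    refine (h ((dist_unroll_le v w).trans_lt ?_)).le
    have : |v - w| ≤ u - s := abs_le.2 ⟨by linarith [hv.1, hw.2], by linarith [hv.2, hw.1]⟩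
    nlinarith
  · congr 1
    rw [← Set.image_add_const_Icc, Set.image_image]
    simp only [unroll_add_one]

end TQuasi

/-! ### The parametrization of the quasicircle -/

open TQuasi in
theorem theorem2506062 (t : ℝ) (ht0 : 0 < t) (ht1 : t ≤ 1) (Γ : Set TQuasi.Plane)
    (hΓ : TQuasi.IsTQuasicircle t Γ) :
    ∃ (R : ℝ) (f : Circle → TQuasi.Plane),
      TQuasi.IsWeaklyQuasisymmetric R t f ∧ Set.range f = Γ := by
  obtain ⟨⟨γ, hγ, hinj, rfl⟩, C, hC, hΓ⟩ := hΓ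
  have hW := arcGauge_diam hγ hinj
  set g : ℝ → Plane := fun v => γ (unroll v) with hg
  have hgc : Continuous g := hγ.comp continuous_unroll
  have hb : ∀ s u, Bornology.IsBounded (g '' Set.Icc s u) :=
    fun s u => (isCompact_Icc.image hgc).isBounded
  obtain ⟨e, he1, hdoub⟩ := hW.exists_orderIso
  have hen : ∀ (x : ℝ) (n : ℤ), e (x + n) = e x + n := fun x n => by
    induction n with
    | zero => simp
    | succ n ih => push_cast at *; rw [← add_assoc, he1, ih]; ring
    | pred n ih =>
      push_cast at *
      have := he1 (x + (-(n : ℝ) - 1))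
      rw [show x + (-(n : ℝ) - 1) + 1 = x + -n by ring, ih] at this
      linarith
  choose ℓ hℓ using fun z => exists_unroll_eq 0 z
  let f : Circle → Plane := fun z => g (e (ℓ z))
  have hf : ∀ x, f (unroll x) = g (e x) := fun x => by
    obtain ⟨n, hn⟩ := unroll_eq_unroll_iff.1 (hℓ (unroll x)).1
    simp only [f, hn, hen, hg]
    congr 1
    exact unroll_eq_unroll_iff.2 ⟨n, rfl⟩
  have hfc : Continuous f := by
    rw [(isOpenMap_unroll.isQuotientMap continuous_unroll fun z =>
      ⟨ℓ z, (hℓ z).1⟩).continuous_iff, show f ∘ unroll = g ∘ e from funext hf]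
    exact hgc.comp e.continuous
  have hfinj : Function.Injective f := fun z w h => by
    obtain ⟨n, hn⟩ := unroll_eq_unroll_iff.1 (hinj h)
    rw [← hen, e.apply_eq_iff_eq] at hn
    rw [← (hℓ z).1, ← (hℓ w).1]
    exact unroll_eq_unroll_iff.2 ⟨n, hn⟩
  -- If both arcs between two points have diameter at least `δ`, so has the subarc provided by the
  -- quasicircle condition.
  have lower : ∀ s u δ : ℝ, s < u → u < s + 1 → δ ≤ Metric.diam (g '' Set.Icc s u) →
      δ ≤ Metric.diam (g '' Set.Icc u (s + 1)) → ∀ z w, z = g s ∧ w = g u ∨ z = g u ∧ w = g s →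
      δ ≤ C * dist z w ^ t := by
    intro s u δ hsu hus h1 h2 z w hzw
    have hne : g s ≠ g u := fun h => by
      obtain ⟨n, hn⟩ := unroll_eq_unroll_iff.1 (hinj h)
      have h3 : (n : ℝ) < 0 := by linarith
      have h4 : (-1 : ℝ) < n := by linarith
      norm_cast at h3
      have h5 : (-1 : ℤ) < n := by exact_mod_cast h4
      omega
    obtain ⟨A, ⟨⟨hAΓ, σ, hσ, -, hσ0, hσ1, rfl⟩, -⟩, hdiam⟩ :=
      hΓ (g s) ⟨_, rfl⟩ (g u) ⟨_, rfl⟩ hne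
    have hd : dist z w = dist (g s) (g u) := by
      obtain ⟨rfl, rfl⟩ | ⟨rfl, rfl⟩ := hzw
      · rfl
      · exact dist_comm _ _
    rw [hd]
    refine le_trans ?_ hdiam
    have hbA := (isCompact_range hσ).isBounded
    obtain hsub | hsub := subset_of_isPreconnected hγ hinj hAΓ (isPreconnected_range hσ) hsu hus
      ⟨0, hσ0⟩ ⟨1, hσ1⟩
    · exact h1.trans (Metric.diam_mono hsub hbA)
    · exact h2.trans (Metric.diam_mono hsub hbA)
  refine ⟨1701 * C, f, ⟨(hfc.isClosedEmbedding hfinj).isEmbedding, fun a b x hab => ?_⟩, ?_⟩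
  · obtain ⟨x, rfl⟩ : ∃ y, unroll y = x := ⟨ℓ x, (hℓ x).1⟩
    obtain ⟨a, rfl, ha⟩ := exists_unroll_eq x a
    obtain ⟨b, rfl, hb2⟩ := exists_unroll_eq x b
    have hle := abs_sub_le_of_dist_unroll_le ha hb2 hab
    rw [hf, hf, hf]
    obtain ⟨r, hr⟩ : ∃ r, r = |b - x| := ⟨_, rfl⟩
    rw [← hr] at hle hb2
    obtain rfl | hr0 : r = 0 ∨ 0 < r := by
      rcases (abs_nonneg (b - x)).eq_or_lt with h | h
      · left; linarith
      · right; linarith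
    · have hbx : b = x := by linarith [abs_eq_zero.1 hr.symm]
      have hax : a = x := by linarith [abs_eq_zero.1 (le_antisymm hle (abs_nonneg _))]
      rw [hbx, hax, dist_self, Real.zero_rpow ht0.ne', mul_zero]
    obtain ⟨d1, d2⟩ := hdoub x r hr0 (by linarith)
    have up : dist (g (e a)) (g (e x)) ≤ Metric.diam (g '' Set.Icc (e (x - r)) (e (x + r))) := by
      obtain ⟨a1, a2⟩ := abs_le.1 hle
      refine Metric.dist_le_diam_of_mem (hb _ _) ⟨e a, ⟨?_, ?_⟩, rfl⟩ ⟨e x, ⟨?_, ?_⟩, rfl⟩ <;>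
      · rw [e.le_iff_le]
        linarith
    have per := hW.periodic
    have fin : Metric.diam (g '' Set.Icc (e (x - r)) (e (x + r))) / 1701 ≤
        C * dist (g (e b)) (g (e x)) ^ t := by
      obtain hbx | hbx : b = x + r ∨ b = x - r := by
        rcases abs_choice (b - x) with h | h
        · left; linarith
        · right; linarith
      -- The complementary arc contains the image of `[x + 1 - r, x + 1]`, a translate of the other
      -- half of `[x - r, x + r]`, because `r ≤ 1 / 2`.
      · refine lower (e x) (e (x + r)) _ ?_ ?_ ?_ ?_ _ _ (Or.inr ⟨by rw [hbx], rfl⟩)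
        · rw [e.lt_iff_lt]; linarith
        · rw [← he1, e.lt_iff_lt]; linarith
        · linarith
        · have := hW.mono (s' := e (x + r)) (s := e (x - r + 1)) (u := e (x + 1))
            (u' := e (x + 1)) (by rw [e.le_iff_le]; linarith) (by rw [e.le_iff_le]; linarith) le_rfl
          rw [he1, he1, per] at this
          linarith
      · refine lower (e (x - r)) (e x) _ ?_ ?_ ?_ ?_ _ _ (Or.inl ⟨by rw [hbx], rfl⟩)
        · rw [e.lt_iff_lt]; linarith
        · rw [← he1, e.lt_iff_lt]; linarith
        · linarith
        · have := hW.mono (s' := e x) (s := e x) (u := e (x + r))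
            (u' := e (x - r + 1)) le_rfl (by rw [e.le_iff_le]; linarith)
            (by rw [e.le_iff_le]; linarith)
          rw [he1] at this
          linarith
    linarith
  · refine Set.Subset.antisymm (Set.range_subset_iff.2 fun z => ⟨_, rfl⟩) ?_
    rintro _ ⟨z, rfl⟩
    refine ⟨unroll (e.symm (ℓ z)), ?_⟩
    rw [hf, e.apply_symm_apply]
    exact congrArg γ (hℓ z).1
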